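/- Let $W$ be the principal branch of the Lambert function, i.e. the inverse of $w\mapsto we^w$ on $[-1,\infty)$, and for integers $k\ge 1$ put $$\rho_k = 1-e^{-kW\left(\sqrt[k]{k!}/k\right)}.$$ In the Top-$1$-of-$k$ problem, independent non-negative random variables $X_1,\dots,X_n$ with known (not necessarily identical) atomless distributions are revealed one by one in an order chosen by an adversary, who may know the algorithm and all realizations. After each revelation the gambler irrevocably accepts or rejects the revealed value; at most $k$ values may be accepted, and the reward $\mathrm{ALG}$ is the highest accepted value ($0$ if none is accepted). For every $k\ge 1$, every $n$ and all such distributions there is a threshold $\tau$, depending only on $k$ and the distributions of $X_1,\dots,X_n$, such that the algorithm that accepts the first $k$ values that are at least $\tau$ (all of them, if there are fewer than $k$) satisfies, whatever the order of arrival, $$\mathbb{E}[\mathrm{ALG}]\ \ge\ \rho_k\cdot \mathbb{E}\left[\max(X_1,\dots,X_n)\right].$$ Moreover, $\rho_k = 1-e^{-kW(1/e)+o(k)}$ as $k\to\infty$. -/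

import Mathlib

open MeasureTheory ProbabilityTheory Filter Asymptotics
open scoped Nat ENNReal

noncomputable section

namespace TopOneOfK

/-- The principal branch of the Lambert `W` function: the inverse of `w ↦ w * exp w`
restricted to `[-1, ∞)` (its value is a default one outside `[-1/e, ∞)`). -/
def lambertW (x : ℝ) : ℝ :=
  Function.invFunOn (fun w : ℝ => w * Real.exp w) (Set.Ici (-1)) x

/-- The bound `1 - exp (-k W((k!)^(1/k) / k))`. -/
def ratio (k : ℕ) : ℝ :=
  1 - Real.exp (-((k : ℝ) * lambertW (((k ! : ℕ) : ℝ) ^ (1 / (k : ℝ)) / (k : ℝ))))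

/-- A (deterministic) online acceptance rule: `A past v` says that the gambler wants to accept
the value `v` just revealed, after the values in `past` were revealed (oldest first). -/
abbrev OnlineRule : Type := List ℝ → ℝ → Prop

/-- The single-threshold rule: want every value that is at least `τ`. -/
def singleThreshold (τ : ℝ) : OnlineRule := fun _ v => τ ≤ v

open Classical in
/-- `reward A k past vs` is the highest value accepted from now on (`0` if nothing is accepted)
when the rule `A` is run, with `k` acceptances left and after `past` has been revealed, on the
values `vs`, which arrive in this order. Decisions are irrevocable. -/
def reward (A : OnlineRule) : ℕ → List ℝ → List ℝ → ℝ
  | _, _, [] => 0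
  | 0, _, _ :: _ => 0
  | k + 1, past, v :: vs =>
      if A past v then max v (reward A k (past ++ [v]) vs)
      else reward A (k + 1) (past ++ [v]) vs

/-- The Top-1-of-`k` reward of the rule `A` on the values `x`, where the `t`-th value to arrive
is `x (σ t)`. -/
def alg (A : OnlineRule) (k : ℕ) {n : ℕ} (σ : Equiv.Perm (Fin n)) (x : Fin n → ℝ) : ℝ :=
  reward A k [] (List.ofFn fun t => x (σ t))

/-- The prophet's reward `max (x 1, …, x n)`. -/
def prophet {n : ℕ} (x : Fin n → ℝ) : ℝ := ⨆ i, x i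

/-- The rule `A` is `α`-competitive for Top-1-of-`k` on the random values `X` arriving in the
(possibly random) order `σ`: `E[ALG] ≥ α E[max X]`. The values are almost surely non-negative
where this is used, so that both expectations exist in `[0, ∞]`. -/
def IsCompetitive {Ω : Type*} [MeasurableSpace Ω] (P : Measure Ω) {n : ℕ}
    (X : Fin n → Ω → ℝ) (σ : Ω → Equiv.Perm (Fin n)) (A : OnlineRule) (k : ℕ) (α : ℝ) : Prop :=
  ENNReal.ofReal α * ∫⁻ ω, ENNReal.ofReal (prophet fun i => X i ω) ∂P
    ≤ ∫⁻ ω, ENNReal.ofReal (alg A k (σ ω) fun i => X i ω) ∂P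

end TopOneOfK

end

/-! Let `r` be the exponent in `ratio k`, so that `r^k / k! = e^{-r}`, and choose `τ` with `P(max <
τ) = e^{-r}`. If the maximum reaches `τ`, the algorithm earns at least `τ`, and it earns the maximum
itself when at most `k` values reach `τ`. Neither bound depends on the order, so the adversary is
harmless.

It remains to compare tails (`mul_lintegral_ofReal_le_of_tail_le`). For `t ≤ τ` the reward reaches
`t` with probability at least `P(max ≥ τ) = 1 - e^{-r}`. For `t > τ`, split `{max ≥ t}` according to
the first index (in the fixed labelling) whose value reaches `t`. Given that index, more than `k`
values reach `τ` only if `k` of the others do, and the conditioning makes this no likelier. A union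
bound over `k`-subsets bounds the conditional probability by `q^k / k!`, where `q = ∑ P(X j ≥ τ)`
(`measureReal_exists_and_card_gt_le`). Since `1 - p ≤ e^{-p}`, `q ≤ r`, so the loss is at most
`e^{-r}`.

The asymptotics follow from Stirling's formula and the Lipschitz continuity of `lambertW`. -/

namespace TopOneOfK

/-! ### The Lambert function and the asymptotics of the ratio. -/

section Lambert

theorem lambertW_mul_exp {x : ℝ} (hx : 0 ≤ x) : lambertW x * Real.exp (lambertW x) = x := by
  have hc : ContinuousOn (fun w : ℝ => w * Real.exp w) (Set.Icc 0 x) := by fun_prop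
  have hmem : x ∈ Set.Icc ((0 : ℝ) * Real.exp 0) (x * Real.exp x) :=
    ⟨by simpa using hx, le_mul_of_one_le_right hx (Real.one_le_exp hx)⟩
  obtain ⟨w, hw, hwx⟩ := intermediate_value_Icc hx hc hmem
  exact Function.invFunOn_eq (f := fun w : ℝ => w * Real.exp w) (s := Set.Ici (-1))
    ⟨w, by simpa using (by linarith [hw.1] : (-1 : ℝ) ≤ w), hwx⟩

theorem lambertW_nonneg {x : ℝ} (hx : 0 ≤ x) : 0 ≤ lambertW x := by
  by_contra! h
  have := mul_neg_of_neg_of_pos h (Real.exp_pos (lambertW x))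
  rw [lambertW_mul_exp hx] at this
  linarith

theorem lambertW_pos {x : ℝ} (hx : 0 < x) : 0 < lambertW x := by
  refine (lambertW_nonneg hx.le).lt_of_ne fun h => ?_
  have := lambertW_mul_exp hx.le
  rw [← h, zero_mul] at this
  exact hx.ne this

/-- The slope of `w * exp w` is at least `1` on `[0, ∞)`; this makes its inverse `1`-Lipschitz
there. -/
theorem sub_le_mul_exp_sub {a b : ℝ} (hb : 0 ≤ b) (hab : b ≤ a) :
    a - b ≤ a * Real.exp a - b * Real.exp b := by
  have h1 : Real.exp b ≤ Real.exp a := Real.exp_le_exp.2 hab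
  have h2 : 1 ≤ Real.exp a := Real.one_le_exp (hb.trans hab)
  nlinarith [mul_le_mul_of_nonneg_left h1 hb]

/-- The Lambert function is `1`-Lipschitz on `[0, ∞)`. -/
theorem abs_lambertW_sub_le {x y : ℝ} (hx : 0 ≤ x) (hy : 0 ≤ y) :
    |lambertW x - lambertW y| ≤ |x - y| := by
  rcases le_total (lambertW y) (lambertW x) with h | h
  · have := sub_le_mul_exp_sub (lambertW_nonneg hy) h
    rw [lambertW_mul_exp hx, lambertW_mul_exp hy] at this
    rw [abs_of_nonneg (sub_nonneg.2 h)]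
    exact this.trans (le_abs_self _)
  · have := sub_le_mul_exp_sub (lambertW_nonneg hx) h
    rw [lambertW_mul_exp hx, lambertW_mul_exp hy] at this
    rw [abs_sub_comm, abs_of_nonneg (sub_nonneg.2 h), abs_sub_comm]
    exact this.trans (le_abs_self _)

/-- `(k!)^(1/k) / k → 1/e`. -/
theorem tendsto_factorial_rpow_div :
    Tendsto (fun k : ℕ => ((k ! : ℕ) : ℝ) ^ (1 / (k : ℝ)) / (k : ℝ)) atTop
      (nhds (1 / Real.exp 1)) := by
  have hinv : Tendsto (fun k : ℕ => ((k : ℝ))⁻¹) atTop (nhds 0) :=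
    tendsto_inv_atTop_nhds_zero_nat
  have h1 : Tendsto (fun k : ℕ => Real.log (Stirling.stirlingSeq k) * ((k : ℝ))⁻¹) atTop
      (nhds 0) := by
    have hpi : √Real.pi ≠ 0 := by positivity
    simpa using (Stirling.tendsto_stirlingSeq_sqrt_pi.log hpi).mul hinv
  have h2 : Tendsto (fun k : ℕ => Real.log k * ((k : ℝ))⁻¹) atTop (nhds 0) := by
    have := (Real.isLittleO_log_id_atTop.tendsto_div_nhds_zero).comp
      (tendsto_natCast_atTop_atTop (R := ℝ))
    simpa [Function.comp_def, div_eq_mul_inv] using this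
  -- The exponent is `log (k!) / k - log k`, rewritten through the Stirling sequence.
  have h3 : Tendsto (fun k : ℕ => Real.exp (Real.log (Stirling.stirlingSeq k) * ((k : ℝ))⁻¹ +
      (1 / 2 * (Real.log 2 * ((k : ℝ))⁻¹ + Real.log k * ((k : ℝ))⁻¹)) - 1)) atTop
      (nhds (Real.exp (0 + (1 / 2 * (Real.log 2 * 0 + 0)) - 1))) :=
    (Real.continuous_exp.tendsto _).comp
      ((h1.add (((hinv.const_mul _).add h2).const_mul _)).sub_const 1)
  have he : Real.exp (0 + (1 / 2 * (Real.log 2 * 0 + 0)) - 1) = 1 / Real.exp 1 := by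
    rw [one_div (Real.exp 1), ← Real.exp_neg]; norm_num
  rw [he] at h3
  refine h3.congr' ?_
  filter_upwards [eventually_ge_atTop 1] with k hk
  have hk0 : (0 : ℝ) < k := by exact_mod_cast hk
  have hf : (0 : ℝ) < ((k ! : ℕ) : ℝ) := by exact_mod_cast k.factorial_pos
  rw [Stirling.log_stirlingSeq_formula, Real.log_mul two_ne_zero hk0.ne',
    Real.log_div hk0.ne' (Real.exp_ne_zero 1), Real.log_exp, Real.rpow_def_of_pos hf]
  conv_rhs => arg 2; rw [← Real.exp_log hk0]
  rw [← Real.exp_sub]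
  congr 1
  field_simp
  ring

theorem exists_isLittleO_ratio_eq :
    ∃ ε : ℕ → ℝ, ε =o[atTop] (fun k : ℕ => (k : ℝ)) ∧
      ∀ k : ℕ, 1 ≤ k → ratio k =
        1 - Real.exp (-((k : ℝ) * lambertW (1 / Real.exp 1)) + ε k) := by
  set x : ℕ → ℝ := fun k => ((k ! : ℕ) : ℝ) ^ (1 / (k : ℝ)) / (k : ℝ) with hx
  refine ⟨fun k => k * (lambertW (1 / Real.exp 1) - lambertW (x k)), ?_, fun k _ => ?_⟩
  · have hd : Tendsto (fun k => lambertW (1 / Real.exp 1) - lambertW (x k)) atTop (nhds 0) := by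
      refine squeeze_zero_norm (a := fun k => |1 / Real.exp 1 - x k|) (fun k => ?_) ?_
      · exact abs_lambertW_sub_le (by positivity) (by simp only [hx]; positivity)
      · simpa [hx] using (tendsto_factorial_rpow_div.const_sub (1 / Real.exp 1)).abs
    simpa using (isBigO_refl (fun k : ℕ => (k : ℝ)) atTop).mul_isLittleO
      ((isLittleO_one_iff ℝ).2 hd)
  · rw [ratio]
    congr 2
    simp only [hx]
    ring

/-- The exponent `k W((k!)^(1/k) / k)` solves `λ^k / k! = e^{-λ}`. -/
theorem exists_ratio_eq_one_sub_exp {k : ℕ} (hk : 1 ≤ k) :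
    ∃ r : ℝ, 0 < r ∧ ratio k = 1 - Real.exp (-r) ∧ r ^ k / (k ! : ℕ) = Real.exp (-r) := by
  have hk0 : (0 : ℝ) < k := by exact_mod_cast hk
  have hf : (0 : ℝ) < ((k ! : ℕ) : ℝ) := by exact_mod_cast k.factorial_pos
  set x : ℝ := ((k ! : ℕ) : ℝ) ^ (1 / (k : ℝ)) / (k : ℝ) with hx
  have hx0 : 0 < x := by positivity
  refine ⟨k * lambertW x, mul_pos hk0 (lambertW_pos hx0), rfl, ?_⟩
  have h1 : (k * lambertW x) * Real.exp (lambertW x) = ((k ! : ℕ) : ℝ) ^ (1 / (k : ℝ)) := by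
    rw [mul_assoc, lambertW_mul_exp hx0.le, hx]
    field_simp
  -- With `r = k * lambertW x`, the `k`-th power of `h1` reads `r^k * e^r = k!`.
  have h2 := congrArg (· ^ k) h1
  simp only [mul_pow _ (Real.exp _), ← Real.exp_nat_mul, one_div] at h2
  rw [Real.rpow_inv_natCast_pow hf.le (by omega)] at h2
  rw [Real.exp_neg, div_eq_iff hf.ne', ← h2]
  field_simp

end Lambert

/-! ### Order-free lower bounds for the reward. -/

section Reward

/-- The budget cannot run out before `v` arrives, since each acceptance uses up one of the at most
`k` values that reach `τ`. -/
theorem le_reward_of_countP_le (τ : ℝ) {v : ℝ} (hv : τ ≤ v) (vs : List ℝ) :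
    ∀ (k : ℕ) (past : List ℝ), v ∈ vs → vs.countP (fun u => decide (τ ≤ u)) ≤ k →
      v ≤ reward (singleThreshold τ) k past vs := by
  induction vs with
  | nil => simp
  | cons u us ih =>
    intro k past hmem hc
    cases k with
    | zero =>
      have := List.countP_eq_zero.1 (Nat.le_zero.1 hc) v hmem
      simp [hv] at this
    | succ k =>
      rw [reward]
      by_cases hu : τ ≤ u
      · rw [if_pos (by exact hu)]
        rw [List.countP_cons_of_pos (by simpa using hu)] at hc
        rcases List.mem_cons.1 hmem with rfl | h
        · exact le_max_left _ _
        · exact (ih k _ h (by omega)).trans (le_max_right _ _)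
      · rw [if_neg (by exact hu)]
        rw [List.countP_cons_of_neg (by simpa using hu)] at hc
        rcases List.mem_cons.1 hmem with rfl | h
        · exact absurd hv hu
        · exact ih (k + 1) _ h hc

theorem threshold_le_reward (τ : ℝ) {v : ℝ} (hv : τ ≤ v) (k : ℕ) (vs : List ℝ) :
    ∀ past : List ℝ, v ∈ vs → τ ≤ reward (singleThreshold τ) (k + 1) past vs := by
  induction vs with
  | nil => simp
  | cons u us ih =>
    intro past hmem
    rw [reward]
    by_cases hu : τ ≤ u
    · rw [if_pos (by exact hu)]
      exact hu.trans (le_max_left _ _)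
    · rw [if_neg (by exact hu)]
      rcases List.mem_cons.1 hmem with rfl | h
      · exact absurd hv hu
      · exact ih _ h

theorem countP_ofFn_perm {n : ℕ} (σ : Equiv.Perm (Fin n)) (x : Fin n → ℝ) (τ : ℝ) :
    (List.ofFn fun t => x (σ t)).countP (fun u => decide (τ ≤ u)) =
      (Finset.univ.filter fun i => τ ≤ x i).card := by
  have h1 : (Finset.univ.filter fun i => τ ≤ x i).card =
      (Finset.univ.filter fun t => τ ≤ x (σ t)).card :=
    (Finset.card_equiv σ (by simp)).symm
  rw [h1, List.ofFn_eq_map, List.countP_map, ← List.toFinset_finRange,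
    (List.nodup_finRange n).card_eq_countP]
  rfl

theorem le_alg_of_card_le {n : ℕ} (σ : Equiv.Perm (Fin n)) (x : Fin n → ℝ) {τ : ℝ} {k : ℕ}
    (hc : (Finset.univ.filter fun i => τ ≤ x i).card ≤ k) {i : Fin n} (hi : τ ≤ x i) :
    x i ≤ alg (singleThreshold τ) k σ x :=
  le_reward_of_countP_le τ hi _ k [] (List.mem_ofFn.2 ⟨σ.symm i, by simp⟩)
    (by rwa [countP_ofFn_perm])

theorem threshold_le_alg {n : ℕ} (σ : Equiv.Perm (Fin n)) (x : Fin n → ℝ) {τ : ℝ} {k : ℕ}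
    (hk : 1 ≤ k) {i : Fin n} (hi : τ ≤ x i) : τ ≤ alg (singleThreshold τ) k σ x := by
  obtain ⟨k, rfl⟩ := Nat.exists_eq_add_of_le' hk
  exact threshold_le_reward τ hi k _ [] (List.mem_ofFn.2 ⟨σ.symm i, by simp⟩)

end Reward

/-! ### An elementary symmetric bound, layer cake, and the choice of threshold. -/

section Analysis

/-- Each squarefree monomial of degree `k` occurs `k!` times in the expansion of the `k`-th power.
The induction splits subsets by whether they contain `a` and keeps two terms of the binomial
expansion of `(q + p a)^(k+1)`. -/
theorem sum_powersetCard_prod_le {ι : Type*} [DecidableEq ι] (p : ι → ℝ) (hp : ∀ i, 0 ≤ p i)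
    (s : Finset ι) : ∀ k : ℕ,
    ∑ S ∈ s.powersetCard k, ∏ i ∈ S, p i ≤ (∑ i ∈ s, p i) ^ k / (k ! : ℕ) := by
  induction s using Finset.induction_on with
  | empty => 
    intro k
    cases k with
    | zero => simp
    | succ k => rw [Finset.powersetCard_eq_empty.2 (by simp)]; simp
  | insert a s ha ih =>
    intro k
    cases k with
    | zero => simp
    | succ k =>
      have hdisj : Disjoint (s.powersetCard (k + 1)) ((s.powersetCard k).image (insert a)) := by
        rw [Finset.disjoint_left]
        intro S hS hS'
        obtain ⟨T, -, rfl⟩ := Finset.mem_image.1 hS'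
        exact ha ((Finset.mem_powersetCard.1 hS).1 (Finset.mem_insert_self _ _))
      have hmem : ∀ T ∈ s.powersetCard k, a ∉ T := fun T hT h =>
        ha ((Finset.mem_powersetCard.1 hT).1 h)
      rw [Finset.powersetCard_succ_insert ha, Finset.sum_union hdisj, Finset.sum_image,
        Finset.sum_insert ha]
      · rw [Finset.sum_congr rfl fun T hT => Finset.prod_insert (hmem T hT), ← Finset.mul_sum]
        set q := ∑ i ∈ s, p i
        have hq : 0 ≤ q := Finset.sum_nonneg fun i _ => hp i
        have h1 := pow_add_mul_le_add_pow hq (b := p a) (by linarith [hp a]) (k + 1)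
        have hf : (0 : ℝ) < ((k ! : ℕ) : ℝ) := by exact_mod_cast k.factorial_pos
        calc _ ≤ q ^ (k + 1) / ((k + 1)! : ℕ) + p a * (q ^ k / (k ! : ℕ)) :=
              add_le_add (ih (k + 1)) (mul_le_mul_of_nonneg_left (ih k) (hp a))
          _ = (q ^ (k + 1) + ((k + 1 : ℕ) : ℝ) * q ^ k * p a) / ((k + 1)! : ℕ) := by
              rw [Nat.factorial_succ]
              push_cast
              field_simp
          _ ≤ _ := by
              rw [add_comm (p a)]
              gcongr
              simpa using h1
      · intro S hS T hT h
        have := congrArg (fun U => U.erase a) h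
        simpa [Finset.erase_insert (hmem S hS), Finset.erase_insert (hmem T hT)] using this

theorem mul_lintegral_ofReal_le_of_tail_le {Ω : Type*} [MeasurableSpace Ω] (P : Measure Ω)
    {f g : Ω → ℝ} (hf : Measurable f) (hg : Measurable g) {c : ℝ≥0∞} (hc : c ≠ ∞)
    (h : ∀ t > 0, c * P {ω | t ≤ f ω} ≤ P {ω | t ≤ g ω}) :
    c * ∫⁻ ω, ENNReal.ofReal (f ω) ∂P ≤ ∫⁻ ω, ENNReal.ofReal (g ω) ∂P := by
  have key : ∀ f : Ω → ℝ, Measurable f → ∫⁻ ω, ENNReal.ofReal (f ω) ∂P =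
      ∫⁻ t in Set.Ioi 0, P {ω | t ≤ f ω} := fun f hf => by
    -- Layer cake for the positive part of `f`, whose tails at `t > 0` are those of `f`.
    have h1 := lintegral_eq_lintegral_meas_le P (f := fun ω => max (f ω) 0)
      (ae_of_all _ fun ω => le_max_right _ _) (hf.max measurable_const).aemeasurable
    simp only [ENNReal.ofReal_max, ENNReal.ofReal_zero, zero_le, sup_of_le_left] at h1
    rw [h1]
    refine setLIntegral_congr_fun measurableSet_Ioi fun t ht => ?_
    simp only [le_max_iff, not_le.2 (Set.mem_Ioi.1 ht), or_false]
  rw [key f hf, key g hg, ← lintegral_const_mul' _ _ hc]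
  exact setLIntegral_mono' measurableSet_Ioi fun t ht => h t ht

/-- A quantile of the maximum of independent nonnegative atomless variables. -/
theorem exists_prod_measureReal_Iio_eq {n : ℕ} (hn : n ≠ 0) (μ : Fin n → Measure ℝ)
    (hμ : ∀ i, IsProbabilityMeasure (μ i)) (hat : ∀ i x, μ i {x} = 0)
    (hpos : ∀ i, μ i (Set.Iio 0) = 0) {q : ℝ} (hq : 0 ≤ q) (hq1 : q < 1) :
    ∃ τ : ℝ, ∏ i, (μ i).real (Set.Iio τ) = q := by
  -- Without atoms the mass of `(-∞, x)` equals that of `(-∞, x]`, and the cdf is continuous.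
  have hcdf : ∀ i, (fun x => (μ i).real (Set.Iio x)) = cdf (μ i) := fun i => by
    ext x
    rw [cdf_eq_real, measureReal_def, measureReal_def, ← Set.Iio_union_right,
      measure_union (by simp) (measurableSet_singleton x), hat, add_zero]
  have hcont : ∀ i, Continuous fun x => (μ i).real (Set.Iio x) := fun i => by
    have hm : (cdf (μ i)).measure = μ i := measure_cdf _
    rw [hcdf i, continuous_iff_continuousAt]
    intro x
    have h1 := (cdf (μ i)).measure_singleton x
    rw [hm, hat, eq_comm, ENNReal.ofReal_eq_zero] at h1
    rw [(cdf (μ i)).mono.continuousAt_iff_leftLim_eq_rightLim, StieltjesFunction.rightLim_eq]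
    exact le_antisymm ((cdf (μ i)).mono.leftLim_le le_rfl) (by linarith)
  have hc : Continuous fun x => ∏ i, (μ i).real (Set.Iio x) :=
    continuous_finsetProd _ fun i _ => hcont i
  have htop : Tendsto (fun x => ∏ i, (μ i).real (Set.Iio x)) atTop (nhds 1) := by
    have := tendsto_finsetProd (Finset.univ : Finset (Fin n)) (f := fun i x =>
      (μ i).real (Set.Iio x)) (a := fun _ => 1) (x := atTop)
      fun i _ => by rw [hcdf i]; exact tendsto_cdf_atTop _
    simpa using this
  -- The product vanishes at `0` by nonnegativity and tends to `1`, so it attains `q` in between.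
  have h0 : ∏ i, (μ i).real (Set.Iio 0) = 0 :=
    Finset.prod_eq_zero (Finset.mem_univ ⟨0, Nat.pos_of_ne_zero hn⟩)
      (by simp [measureReal_def, hpos])
  obtain ⟨b, hqb, hb⟩ := ((htop.eventually (lt_mem_nhds hq1)).and (eventually_ge_atTop 0)).exists
  obtain ⟨τ, -, h⟩ := intermediate_value_Icc hb hc.continuousOn
    (⟨by simpa [h0] using hq, hqb.le⟩ : q ∈ Set.Icc _ _)
  exact ⟨τ, h⟩

end Analysis

/-! ### Few values reach the threshold, even given a large maximum. -/

section Tail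

variable {Ω : Type*} {n : ℕ} {X : Fin n → Ω → ℝ}

/-- The set of values that coordinate `j` takes when `i` is the first index whose value is at
least `t`. -/
def firstSet (t : ℝ) (i j : Fin n) : Set ℝ :=
  if j = i then Set.Ici t else if j < i then Set.Iio t else Set.univ

theorem measurableSet_firstSet (t : ℝ) (i j : Fin n) : MeasurableSet (firstSet t i j) := by
  unfold firstSet
  split_ifs <;> measurability

theorem exists_mem_iInter_firstSet {t : ℝ} {ω : Ω} {i : Fin n} (hi : t ≤ X i ω) :
    ∃ i, ω ∈ ⋂ j, X j ⁻¹' firstSet t i j := by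
  classical
  induction i using WellFoundedLT.induction with
  | ind i ih =>
    by_cases h : ∃ j < i, t ≤ X j ω
    · obtain ⟨j, hj, hjt⟩ := h
      exact ih j hj hjt
    · push Not at h
      refine ⟨i, Set.mem_iInter.2 fun j => ?_⟩
      rw [Set.mem_preimage, firstSet]
      split_ifs with h1 h2
      · subst h1; exact hi
      · exact h j h2
      · trivial

theorem le_of_mem_iInter_firstSet {t : ℝ} {ω : Ω} {i : Fin n}
    (h : ω ∈ ⋂ j, X j ⁻¹' firstSet t i j) : t ≤ X i ω := by
  have := Set.mem_iInter.1 h i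
  simpa [firstSet] using this

theorem pairwise_disjoint_iInter_firstSet (t : ℝ) :
    Pairwise (Function.onFun Disjoint fun i => ⋂ j, X j ⁻¹' firstSet t i j) := by
  have key : ∀ i i' : Fin n, i < i' → Disjoint (⋂ j, X j ⁻¹' firstSet t i j)
      (⋂ j, X j ⁻¹' firstSet t i' j) := fun i i' h => by
    rw [Set.disjoint_left]
    intro ω h1 h2
    have h3 := Set.mem_iInter.1 h2 i
    rw [Set.mem_preimage, firstSet, if_neg h.ne, if_pos h] at h3
    exact absurd (le_of_mem_iInter_firstSet h1) (not_le.2 h3)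
  intro i i' h
  rcases lt_or_gt_of_ne h with h | h
  · exact key _ _ h
  · exact (key _ _ h).symm

variable [MeasurableSpace Ω] {P : Measure Ω}

theorem measureReal_iInter_preimage (hX : iIndepFun X P) {B : Fin n → Set ℝ}
    (hB : ∀ j, MeasurableSet (B j)) :
    P.real (⋂ j, X j ⁻¹' B j) = ∏ j, P.real (X j ⁻¹' B j) := by
  have := hX.measure_inter_preimage_eq_mul Finset.univ (sets := B) fun j _ => hB j
  simp only [Finset.mem_univ, Set.iInter_true] at this
  rw [measureReal_def, this, ENNReal.toReal_prod]
  rfl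

variable [IsProbabilityMeasure P]

theorem sum_measureReal_iInter_firstSet (hm : ∀ i, Measurable (X i)) (t : ℝ) :
    ∑ i, P.real (⋂ j, X j ⁻¹' firstSet t i j) = P.real {ω | ∃ i, t ≤ X i ω} := by
  have hU : {ω | ∃ i, t ≤ X i ω} = ⋃ i, ⋂ j, X j ⁻¹' firstSet t i j := by
    ext ω
    rw [Set.mem_iUnion]
    exact ⟨fun ⟨i, hi⟩ => exists_mem_iInter_firstSet hi,
      fun ⟨i, hi⟩ => ⟨i, le_of_mem_iInter_firstSet hi⟩⟩
  rw [hU, measureReal_iUnion_fintype (pairwise_disjoint_iInter_firstSet t)]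
  exact fun i => MeasurableSet.iInter fun j => hm j (measurableSet_firstSet t i j)

theorem measureReal_firstSet_inter_Ici_le (hm : ∀ i, Measurable (X i)) {τ t : ℝ} (ht : τ ≤ t)
    {i j : Fin n} (hij : j ≠ i) :
    P.real (X j ⁻¹' (firstSet t i j ∩ Set.Ici τ)) ≤
      P.real (X j ⁻¹' firstSet t i j) * P.real (X j ⁻¹' Set.Ici τ) := by
  rw [firstSet, if_neg hij]
  split_ifs
  · have h := measureReal_union_add_inter (μ := P) (s := X j ⁻¹' Set.Iio t)
      (t := X j ⁻¹' Set.Ici τ) (hm j measurableSet_Ici)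
    have hu : X j ⁻¹' Set.Iio t ∪ X j ⁻¹' Set.Ici τ = Set.univ := by
      rw [← Set.preimage_union, Set.Iio_union_Ici_of_le ht, Set.preimage_univ]
    rw [hu, probReal_univ] at h
    rw [Set.preimage_inter]
    -- With `a = P(X j < t)` and `b = P(X j ≥ τ)`, the intersection has mass `a + b - 1`, and `(1 -
    -- a) * (1 - b) ≥ 0`.
    nlinarith [mul_nonneg (sub_nonneg.2 (measureReal_le_one (μ := P) (s := X j ⁻¹' Set.Iio t)))
      (sub_nonneg.2 (measureReal_le_one (μ := P) (s := X j ⁻¹' Set.Ici τ)))]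
  · simp

/-- Conditioning on `i` being the first index whose value reaches `t` only makes it less likely
that all the values indexed by `S ∌ i` reach `τ ≤ t`. -/
theorem measureReal_first_inter_le (hm : ∀ i, Measurable (X i)) (hX : iIndepFun X P) {τ t : ℝ}
    (ht : τ ≤ t) {i : Fin n} {S : Finset (Fin n)} (hS : i ∉ S) :
    P.real ((⋂ j, X j ⁻¹' firstSet t i j) ∩ {ω | ∀ j ∈ S, τ ≤ X j ω}) ≤
      P.real (⋂ j, X j ⁻¹' firstSet t i j) * ∏ j ∈ S, P.real (X j ⁻¹' Set.Ici τ) := by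
  have hset : (⋂ j, X j ⁻¹' firstSet t i j) ∩ {ω | ∀ j ∈ S, τ ≤ X j ω} =
      ⋂ j, X j ⁻¹' (firstSet t i j ∩ if j ∈ S then Set.Ici τ else Set.univ) := by
    ext ω
    simp only [Set.mem_inter_iff, Set.mem_iInter, Set.mem_preimage, Set.mem_ofPred_eq,
      forall_and]
    refine and_congr_right fun _ => forall_congr' fun j => ?_
    by_cases h : j ∈ S <;> simp [h]
  rw [hset, measureReal_iInter_preimage hX, measureReal_iInter_preimage hX
    (measurableSet_firstSet t i), ← Finset.prod_ite_mem_eq S, ← Finset.prod_mul_distrib]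
  · refine Finset.prod_le_prod (fun j _ => measureReal_nonneg) fun j _ => ?_
    by_cases h : j ∈ S
    · rw [if_pos h, if_pos h]
      exact measureReal_firstSet_inter_Ici_le hm ht fun hji => hS (hji ▸ h)
    · rw [if_neg h, if_neg h, Set.inter_univ, mul_one]
  · intro j
    refine (measurableSet_firstSet t i j).inter ?_
    split_ifs <;> measurability

theorem measureReal_exists_and_card_gt_le (hm : ∀ i, Measurable (X i)) (hX : iIndepFun X P)
    {τ t : ℝ} (ht : τ ≤ t) (k : ℕ) :
    P.real {ω | (∃ i, t ≤ X i ω) ∧ k < (Finset.univ.filter fun i => τ ≤ X i ω).card} ≤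
      P.real {ω | ∃ i, t ≤ X i ω} * ((∑ j, P.real (X j ⁻¹' Set.Ici τ)) ^ k / (k ! : ℕ)) := by
  have hsub : {ω | (∃ i, t ≤ X i ω) ∧ k < (Finset.univ.filter fun i => τ ≤ X i ω).card} ⊆
      ⋃ i ∈ (Finset.univ : Finset (Fin n)), ⋃ S ∈ (Finset.univ.erase i).powersetCard k,
        (⋂ j, X j ⁻¹' firstSet t i j) ∩ {ω | ∀ j ∈ S, τ ≤ X j ω} := by
    rintro ω ⟨⟨i₀, hi₀⟩, hcard⟩
    obtain ⟨i, hi⟩ := exists_mem_iInter_firstSet hi₀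
    -- Discarding the first index that reaches `t` costs one of more than `k` indices, so `k` others
    -- remain.
    have hle : k ≤ ((Finset.univ.filter fun i => τ ≤ X i ω).erase i).card := by
      have := Finset.pred_card_le_card_erase (s := Finset.univ.filter fun i => τ ≤ X i ω) (a := i)
      omega
    obtain ⟨S, hS, hSk⟩ := Finset.exists_subset_card_eq hle
    simp only [Set.mem_iUnion]
    refine ⟨i, Finset.mem_univ i, S, Finset.mem_powersetCard.2
      ⟨hS.trans (Finset.erase_subset_erase _ (Finset.filter_subset _ _)), hSk⟩, hi, fun j hj => ?_⟩
    exact (Finset.mem_filter.1 (Finset.mem_of_mem_erase (hS hj))).2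
  have hp : ∀ j, 0 ≤ P.real (X j ⁻¹' Set.Ici τ) := fun j => measureReal_nonneg
  calc _ ≤ ∑ i, ∑ S ∈ (Finset.univ.erase i).powersetCard k,
        P.real ((⋂ j, X j ⁻¹' firstSet t i j) ∩ {ω | ∀ j ∈ S, τ ≤ X j ω}) :=
        (measureReal_mono hsub (measure_ne_top _ _)).trans ((measureReal_biUnion_finset_le _ _).trans
          (Finset.sum_le_sum fun i _ => measureReal_biUnion_finset_le _ _))
    _ ≤ ∑ i, ∑ S ∈ (Finset.univ.erase i).powersetCard k,
        P.real (⋂ j, X j ⁻¹' firstSet t i j) * ∏ j ∈ S, P.real (X j ⁻¹' Set.Ici τ) :=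
        Finset.sum_le_sum fun i _ => Finset.sum_le_sum fun S hS =>
          measureReal_first_inter_le hm hX ht fun h =>
            Finset.notMem_erase i _ ((Finset.mem_powersetCard.1 hS).1 h)
    _ ≤ ∑ i, P.real (⋂ j, X j ⁻¹' firstSet t i j) *
        ((∑ j, P.real (X j ⁻¹' Set.Ici τ)) ^ k / (k ! : ℕ)) := by
        refine Finset.sum_le_sum fun i _ => ?_
        rw [← Finset.mul_sum]
        refine mul_le_mul_of_nonneg_left ?_ measureReal_nonneg
        refine (Finset.sum_le_sum_of_subset_of_nonneg
          (Finset.powersetCard_mono (Finset.erase_subset i _))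
          fun S _ _ => Finset.prod_nonneg fun j _ => hp j).trans
          (sum_powersetCard_prod_le _ hp _ k)
    _ = _ := by rw [← Finset.sum_mul, sum_measureReal_iInter_firstSet hm]

end Tail

/-! ### Competitiveness of the threshold. -/

section Competitive

theorem le_prophet_iff {n : ℕ} (hn : n ≠ 0) (x : Fin n → ℝ) (t : ℝ) :
    t ≤ prophet x ↔ ∃ i, t ≤ x i := by
  have : Nonempty (Fin n) := ⟨⟨0, Nat.pos_of_ne_zero hn⟩⟩
  constructor
  · intro h
    obtain ⟨i, hi⟩ := exists_eq_ciSup_of_finite (f := x)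
    exact ⟨i, hi ▸ h⟩
  · rintro ⟨i, hi⟩
    exact hi.trans (le_ciSup (Finite.bddAbove_range x) i)

/-- A threshold reached by the maximum with probability `1 - e^{-r}`, where `r^k / k! ≤ e^{-r}`,
is `(1 - e^{-r})`-competitive. -/
theorem isCompetitive_singleThreshold {Ω : Type*} [MeasurableSpace Ω] {P : Measure Ω}
    [IsProbabilityMeasure P] {n : ℕ} (hn : n ≠ 0) {X : Fin n → Ω → ℝ}
    (σ : Ω → Equiv.Perm (Fin n)) (hm : ∀ i, Measurable (X i)) (hX : iIndepFun X P)
    {k : ℕ} (hk : 1 ≤ k) {r τ : ℝ} (hr : r ^ k / (k ! : ℕ) ≤ Real.exp (-r))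
    (hτ : ∏ i, P.real (X i ⁻¹' Set.Iio τ) = Real.exp (-r)) :
    IsCompetitive P X σ (singleThreshold τ) k (1 - Real.exp (-r)) := by
  classical
  have hcompl : ∀ i, P.real (X i ⁻¹' Set.Iio τ) = 1 - P.real (X i ⁻¹' Set.Ici τ) := fun i => by
    rw [← Set.compl_Ici, Set.preimage_compl, probReal_compl_eq_one_sub (hm i measurableSet_Ici)]
  -- From `e^{-r} = ∏ (1 - p i) ≤ e^{-∑ p i}`, where `p i = P(X i ≥ τ)`.
  have hsum : ∑ i, P.real (X i ⁻¹' Set.Ici τ) ≤ r := by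
    have h1 : Real.exp (-r) ≤ Real.exp (-∑ i, P.real (X i ⁻¹' Set.Ici τ)) := by
      rw [← hτ, ← Finset.sum_neg_distrib, Real.exp_sum]
      refine Finset.prod_le_prod (fun i _ => measureReal_nonneg) fun i _ => ?_
      rw [hcompl i]
      exact Real.one_sub_le_exp_neg _
    linarith [Real.exp_le_exp.1 h1]
  have hsum0 : 0 ≤ ∑ i, P.real (X i ⁻¹' Set.Ici τ) :=
    Finset.sum_nonneg fun i _ => measureReal_nonneg
  have hpow : (∑ i, P.real (X i ⁻¹' Set.Ici τ)) ^ k / (k ! : ℕ) ≤ Real.exp (-r) :=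
    (by gcongr : _ ≤ r ^ k / ((k ! : ℕ) : ℝ)).trans hr
  set M : Ω → ℝ := fun ω => prophet fun i => X i ω with hM
  have hMle : ∀ t ω, t ≤ M ω ↔ ∃ i, t ≤ X i ω := fun t ω => le_prophet_iff hn _ t
  have hMm : Measurable M := Measurable.iSup hm
  set N : Ω → ℕ := fun ω => (Finset.univ.filter fun i => τ ≤ X i ω).card with hN
  have hNm : Measurable N := by
    have : N = fun ω => ∑ i, if τ ≤ X i ω then 1 else 0 := by
      ext ω; simp only [hN, Finset.card_filter]
    rw [this]
    exact Finset.measurable_sum _ fun i _ =>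
      Measurable.ite (measurableSet_le measurable_const (hm i)) measurable_const measurable_const
  have hNk : MeasurableSet {ω | N ω ≤ k} := measurableSet_le hNm measurable_const
  have hMt : ∀ t, MeasurableSet {ω | t ≤ M ω} := fun t => measurableSet_le measurable_const hMm
  -- `g` is a lower bound for the reward that does not depend on the order of arrival.
  set g : Ω → ℝ := fun ω => if τ ≤ M ω then (if N ω ≤ k then M ω else τ) else 0 with hg
  have hgm : Measurable g :=
    Measurable.ite (hMt τ) (Measurable.ite hNk hMm measurable_const) measurable_const
  have hgle : ∀ ω, ENNReal.ofReal (g ω) ≤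
      ENNReal.ofReal (alg (singleThreshold τ) k (σ ω) fun i => X i ω) := fun ω => by
    simp only [hg]
    split_ifs with h1 h2
    · obtain ⟨i, hi⟩ := (hMle (M ω) ω).1 le_rfl
      exact ENNReal.ofReal_le_ofReal (hi.trans (le_alg_of_card_le (σ ω) _ h2 (h1.trans hi)))
    · obtain ⟨i, hi⟩ := (hMle τ ω).1 h1
      exact ENNReal.ofReal_le_ofReal (threshold_le_alg (σ ω) (fun i => X i ω) hk hi)
    · simp
  refine (mul_lintegral_ofReal_le_of_tail_le P hMm hgm ENNReal.ofReal_ne_top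
    fun t _ => ?_).trans (lintegral_mono hgle)
  have hreal : (1 - Real.exp (-r)) * P.real {ω | t ≤ M ω} ≤ P.real {ω | t ≤ g ω} := by
    rcases le_or_gt t τ with h | h
    -- Low levels: once the maximum reaches `τ`, the lower bound `g` is at least `τ ≥ t`.
    · have h1 : {ω | τ ≤ M ω} ⊆ {ω | t ≤ g ω} := fun ω (hω : τ ≤ M ω) => by
        simp only [Set.mem_ofPred_eq, hg, if_pos hω]
        split_ifs
        exacts [h.trans hω, h]
      have h2 : P.real {ω | τ ≤ M ω} = 1 - Real.exp (-r) := by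
        have : {ω | τ ≤ M ω} = (⋂ i, X i ⁻¹' Set.Iio τ)ᶜ := by
          ext ω; simp [hMle]
        rw [this, probReal_compl_eq_one_sub
          (MeasurableSet.iInter fun i => hm i measurableSet_Iio),
          measureReal_iInter_preimage hX fun _ => measurableSet_Iio, hτ]
      have h0 : 0 ≤ 1 - Real.exp (-r) := h2 ▸ measureReal_nonneg
      calc _ ≤ (1 - Real.exp (-r)) * 1 := mul_le_mul_of_nonneg_left measureReal_le_one h0
        _ = P.real {ω | τ ≤ M ω} := by rw [h2, mul_one]
        _ ≤ _ := measureReal_mono h1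
    -- High levels: `g` equals the maximum unless more than `k` values reach `τ`, which costs at
    -- most the fraction `e^{-r}` of `P(M ≥ t)`.
    · have h1 : {ω | t ≤ M ω} ∩ {ω | N ω ≤ k} ⊆ {ω | t ≤ g ω} := fun ω hω => by
        have h2 : t ≤ M ω := hω.1
        have h3 : N ω ≤ k := hω.2
        simpa only [Set.mem_ofPred_eq, hg, if_pos (h.le.trans h2), if_pos h3] using h2
      have h2 := measureReal_exists_and_card_gt_le hm hX h.le k
      have h3 : {ω | (∃ i, t ≤ X i ω) ∧ k < (Finset.univ.filter fun i => τ ≤ X i ω).card} =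
          {ω | t ≤ M ω} \ {ω | N ω ≤ k} := by
        ext ω; simp [hMle, hN]
      have h4 : {ω | ∃ i, t ≤ X i ω} = {ω | t ≤ M ω} := by ext ω; simp [hMle]
      rw [h3, h4] at h2
      have h5 := measureReal_inter_add_sdiff (μ := P) (s := {ω | t ≤ M ω}) hNk
      have h6 := mul_le_mul_of_nonneg_left hpow
        (measureReal_nonneg (μ := P) (s := {ω | t ≤ M ω}))
      have h7 := measureReal_mono (μ := P) h1
      linarith
  have := ENNReal.ofReal_le_ofReal hreal
  rwa [ENNReal.ofReal_mul' measureReal_nonneg, ofReal_measureReal, ofReal_measureReal] at this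

end Competitive

end TopOneOfK

theorem mainTheorem3 :
    (∀ k : ℕ, 1 ≤ k → ∀ (n : ℕ) (μ : Fin n → Measure ℝ),
      (∀ i, IsProbabilityMeasure (μ i)) → (∀ i x, μ i {x} = 0) →
      (∀ i, μ i (Set.Iio 0) = 0) →
      ∃ τ : ℝ, ∀ (Ω : Type*) [MeasurableSpace Ω] (P : Measure Ω) [IsProbabilityMeasure P]
        (X : Fin n → Ω → ℝ) (σ : Ω → Equiv.Perm (Fin n)),
        (∀ i, Measurable (X i)) → (∀ i, P.map (X i) = μ i) → iIndepFun X P →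
        (∀ π, MeasurableSet (σ ⁻¹' {π})) →
        TopOneOfK.IsCompetitive P X σ (TopOneOfK.singleThreshold τ) k (TopOneOfK.ratio k)) ∧
    (∃ ε : ℕ → ℝ, ε =o[atTop] (fun k : ℕ => (k : ℝ)) ∧
      ∀ k : ℕ, 1 ≤ k → TopOneOfK.ratio k =
        1 - Real.exp (-((k : ℝ) * TopOneOfK.lambertW (1 / Real.exp 1)) + ε k)) := by
  refine ⟨fun k hk n μ hμ hat hpos => ?_, TopOneOfK.exists_isLittleO_ratio_eq⟩
  rcases Nat.eq_zero_or_pos n with rfl | hn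
  -- With no variables the prophet's supremum over the empty type is `0`, so any threshold works.
  · refine ⟨0, fun Ω _ P _ X σ _ _ _ _ => ?_⟩
    simp [TopOneOfK.IsCompetitive, TopOneOfK.prophet]
  · obtain ⟨r, hr0, hratio, hr⟩ := TopOneOfK.exists_ratio_eq_one_sub_exp hk
    obtain ⟨τ, hτ⟩ := TopOneOfK.exists_prod_measureReal_Iio_eq hn.ne' μ hμ hat hpos
      (Real.exp_pos (-r)).le (by simpa using hr0)
    refine ⟨τ, fun Ω _ P _ X σ hm hmap hX _ => ?_⟩
    rw [hratio]
    refine TopOneOfK.isCompetitive_singleThreshold hn.ne' σ hm hX hk hr.le ?_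
    rw [← hτ]
    exact Finset.prod_congr rfl fun i _ => by
      rw [← hmap i, map_measureReal_apply (hm i) measurableSet_Iio]
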